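/- Let $n\ge 0$ be an integer. For $m\ge 0$ let $\mathcal A_m=\{1<\dots<m\}$ and let $\mathcal A_m^*$ be the free monoid on $\mathcal A_m$. The stylic monoid $\mathsf{styl}_m$ of rank $m$ is the monoid presented by the generators $\mathcal A_m$ and the relations $acb=cab$ for $a\le b<c$, $bac=bca$ for $a<b\le c$ (the Knuth relations), and $a^2=a$, for letters $a,b,c\in\mathcal A_m$. The right patience-sorting monoid $\mathsf{rPS}_n$ of rank $n$ is the quotient of $\mathcal A_n^*$ by the congruence that relates two words if and only if they have the same rPS tableau. Here the rPS tableau of a word is a finite list of non-empty columns, built by starting from the empty list and inserting the letters of the word one by one from left to right: if a letter $a$ is strictly greater than every bottom entry of the columns, then $a$ forms a new column to the right of all the others; otherwise $a$ is put at the bottom of the leftmost column whose bottom entry is greater than or equal to $a$. A monoid $M$ satisfies an identity $u\approx v$ between words over an alphabet $X$ if $\psi(u)=\psi(v)$ for every monoid morphism $\psi\colon X^*\to M$. A variety is a class of monoids closed under homomorphic images, submonoids and arbitrary direct products, and $\mathcal V(M)$ denotes the smallest variety containing $M$. Then $\mathsf{rPS}_n$ satisfies the identity $(xy)^{n+1}\approx(xy)^n\,yx$,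 and $\mathsf{styl}_{n+2}\notin\mathcal V(\mathsf{rPS}_n)$. -/

import Mathlib

namespace PlacticLike

/-! ### Identities and varieties of monoids -/

universe u v

/-- A monoid `M` satisfies the monoid identity `l ≈ r`, where `l` and `r` are words over an
alphabet of variables `X`, if `ψ l = ψ r` for every evaluation `ψ : X* → M`. -/
def SatisfiesIdentity (M : Type u) [Monoid M] {X : Type v} (l r : FreeMonoid X) : Prop :=
  ∀ ψ : FreeMonoid X →* M, ψ l = ψ r

/-- A class of monoids is a variety if it is closed under homomorphic images, submonoids and
direct products. -/
structure IsVariety (C : Set MonCat.{u}) : Prop where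
  image : ∀ M N : MonCat.{u}, M ∈ C → ∀ f : M →* N, Function.Surjective f → N ∈ C
  submonoid : ∀ M : MonCat.{u}, M ∈ C → ∀ S : Submonoid M, MonCat.of S ∈ C
  product : ∀ (ι : Type u) (M : ι → MonCat.{u}), (∀ i, M i ∈ C) → MonCat.of (∀ i, M i) ∈ C

/-- The variety generated by a monoid `M`: the smallest variety containing `M`. -/
def variety (M : Type u) [Monoid M] : Set MonCat.{u} :=
  ⋂₀ {C | IsVariety C ∧ MonCat.of M ∈ C}

theorem isLeast_variety (M : Type u) [Monoid M] :
    IsLeast {C | IsVariety C ∧ MonCat.of M ∈ C} (variety M) := by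
  refine ⟨⟨⟨?_, ?_, ?_⟩, fun C hC => hC.2⟩, fun C hC => Set.sInter_subset_of_mem hC⟩
  · intro A B hA f hf C hC
    exact hC.1.image A B (hA C hC) f hf
  · intro A hA S C hC
    exact hC.1.submonoid A (hA C hC) S
  · intro ι A hA C hC
    exact hC.1.product ι A fun i => hA i C hC

/-! ### The stylic monoid -/

section Stylic

open FreeMonoid (of)

/-- The plactic (Knuth) relations over an ordered alphabet. -/
inductive PlacRel {α : Type u} [LinearOrder α] : FreeMonoid α → FreeMonoid α → Prop
  | knuth₁ (a b c : α) : a ≤ b → b < c → PlacRel (of a * of c * of b) (of c * of a * of b)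
  | knuth₂ (a b c : α) : a < b → b ≤ c → PlacRel (of b * of a * of c) (of b * of c * of a)

/-- The stylic relations: the plactic relations, and `a ^ 2 = a` for every letter `a`. -/
inductive StylRel {α : Type u} [LinearOrder α] : FreeMonoid α → FreeMonoid α → Prop
  | plac (l r : FreeMonoid α) : PlacRel l r → StylRel l r
  | idem (a : α) : StylRel (of a * of a) (of a)

/-- The stylic monoid of rank `n`, over the alphabet `Fin n` with its usual order. -/
abbrev Styl (n : ℕ) : Type := PresentedMonoid (StylRel (α := Fin n))

end Stylic

/-! ### The right patience-sorting monoid -/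

section PatienceSorting

variable {α : Type u} [LinearOrder α]

/-- Insertion of a letter `a` into an rPS tableau. A tableau is the list of its columns from left
to right, and a column is the list of its entries from bottom to top. If `a` is strictly greater
than every entry of the bottom row, then `a` starts a new column at the right end; otherwise `a` is
put at the bottom of the leftmost column whose bottom entry is greater than or equal to `a`.
(The second case does not occur: the columns of a tableau are non-empty.) -/
def rpsInsert : List (List α) → α → List (List α)
  | [], a => [[a]]
  | [] :: T, a => [a] :: T
  | (b :: C) :: T, a => if a ≤ b then (a :: b :: C) :: T else (b :: C) :: rpsInsert T a

/-- The rPS tableau of a word: its letters are inserted one by one, from left to right, starting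
from the empty tableau. -/
def rpsTableau (w : FreeMonoid α) : List (List α) :=
  w.toList.foldl rpsInsert []

/-- All columns of `T` are non-empty, and its bottom row is strictly increasing, with entries
greater than `b`. -/
def Above : WithBot α → List (List α) → Prop
  | _, [] => True
  | _, [] :: _ => False
  | b, (d :: _) :: T => b < (d : WithBot α) ∧ Above d T

theorem above_rpsInsert (T : List (List α)) (b : WithBot α) (a : α) (hT : Above b T)
    (ha : b < (a : WithBot α)) : Above b (rpsInsert T a) := by
  induction T generalizing b with
  | nil => exact ⟨ha, trivial⟩
  | cons D T ih =>
    cases D with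
    | nil => exact hT.elim
    | cons d D =>
      obtain ⟨h₁, h₂⟩ := hT
      by_cases h : a ≤ d
      · rw [rpsInsert, if_pos h]
        refine ⟨ha, ?_⟩
        cases T with
        | nil => trivial
        | cons E T =>
          cases E with
          | nil => exact h₂.elim
          | cons e E => exact ⟨lt_of_le_of_lt (WithBot.coe_le_coe.2 h) h₂.1, h₂.2⟩
      · rw [rpsInsert, if_neg h]
        exact ⟨h₁, ih d h₂ (WithBot.coe_lt_coe.2 (not_le.1 h))⟩

/-- Auxiliary for left insertion: the entries `K` are pushed into the tableau from the left. -/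
def rpsPush : List α → List (List α) → List (List α)
  | [], T => T
  | m :: K, [] => [m :: K]
  | m :: K, C :: T =>
    (C.takeWhile (· ≤ m) ++ m :: K) :: rpsPush (C.dropWhile (· ≤ m)) T

theorem rpsPush_cons (T : List (List α)) (c b : α) (C : List α) (hT : Above b T) (hc : c ≤ b) :
    rpsPush (c :: b :: C) T = rpsInsert (rpsPush (b :: C) T) c := by
  cases T with
  | nil => simp [rpsPush, rpsInsert, hc]
  | cons D T =>
    cases D with
    | nil => exact hT.elim
    | cons d D =>
      have h₁ : b < d := WithBot.coe_lt_coe.1 hT.1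
      have h₂ : c < d := lt_of_le_of_lt hc h₁
      simp [rpsPush, rpsInsert, hc, not_le.2 h₁, not_le.2 h₂]

theorem rpsPush_rpsInsert (T : List (List α)) (K : List α) (b : WithBot α) (hT : Above b T)
    (c : α) : rpsPush K (rpsInsert T c) = rpsInsert (rpsPush K T) c := by
  induction T generalizing K b with
  | nil =>
    cases K with
    | nil => rfl
    | cons m K => by_cases h : c ≤ m <;> simp [rpsPush, rpsInsert, h]
  | cons D T ih =>
    cases K with
    | nil => simp [rpsPush]
    | cons m K =>
      cases D with
      | nil => exact hT.elim
      | cons d D =>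
        have ih' := fun K => ih K d hT.2
        by_cases hcd : c ≤ d
        · by_cases hcm : c ≤ m
          · by_cases hdm : d ≤ m <;> simp [rpsPush, rpsInsert, hcd, hcm, hdm]
          · have hdm : ¬ d ≤ m := fun h => hcm (hcd.trans h)
            simp [rpsPush, rpsInsert, hcd, hcm, hdm, rpsPush_cons T c d D hT.2 hcd]
        · by_cases hdm : d ≤ m
          · simp [rpsPush, rpsInsert, hcd, hdm, ih']
          · have hcm : ¬ c ≤ m := fun h => hdm ((not_le.1 hcd).le.trans h)
            simp [rpsPush, rpsInsert, hcd, hcm, hdm, ih']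

theorem rpsPush_foldl (a : α) (w : List α) (T : List (List α)) (hT : Above ⊥ T) :
    rpsPush [a] (w.foldl rpsInsert T) = w.foldl rpsInsert (rpsPush [a] T) := by
  induction w generalizing T with
  | nil => rfl
  | cons c w ih =>
    rw [List.foldl_cons, List.foldl_cons, ih _ (above_rpsInsert T ⊥ c hT (WithBot.bot_lt_coe c)),
      rpsPush_rpsInsert T [a] ⊥ hT c]

theorem rpsTableau_of_mul (a : α) (w : FreeMonoid α) :
    rpsTableau (FreeMonoid.of a * w) = rpsPush [a] (rpsTableau w) :=
  (rpsPush_foldl a w.toList [] trivial).symm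

theorem rpsTableau_mul (l r : FreeMonoid α) :
    rpsTableau (l * r) = r.toList.foldl rpsInsert (rpsTableau l) := by
  simp [rpsTableau]

/-- The rPS congruence: two words are related if they have the same rPS tableau. -/
def rpsCon (α : Type u) [LinearOrder α] : Con (FreeMonoid α) where
  r l r := rpsTableau l = rpsTableau r
  iseqv := ⟨fun _ => rfl, fun h => h.symm, fun h h' => h.trans h'⟩
  mul' := by
    intro l l' r r' hl hr
    have key : ∀ w : FreeMonoid α, rpsTableau (w * r) = rpsTableau (w * r') := by
      intro w
      induction w using FreeMonoid.inductionOn' with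
      | one => simpa using hr
      | of_mul a w ih => rw [mul_assoc, mul_assoc, rpsTableau_of_mul, rpsTableau_of_mul, ih]
    refine Eq.trans ?_ (key l')
    rw [rpsTableau_mul, rpsTableau_mul]
    exact congrArg (List.foldl rpsInsert · r.toList) hl

/-- The right patience-sorting monoid of rank `n`, over the alphabet `Fin n` with its usual
order. -/
abbrev RPS (n : ℕ) : Type := (rpsCon (Fin n)).Quotient

end PatienceSorting

end PlacticLike

/-! An identity of a monoid passes to its variety, so an identity of `RPS n` that fails in `Styl (n
+ 2)` suffices. In `RPS n`: while `w` is repeatedly inserted, its `i` smallest possible letters sit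
permanently in the bottom row after `i` copies (`Saturated.foldl_succ`). After `n` copies every
letter of `w` is there, so each further letter just lengthens the column it already ends, and such
insertions commute (`rpsInsert_comm`). With `w = xy`, the final `xy` may become `yx`. In `Styl (n +
2)`: letters act on `ℕ` by `descend`. Take `x = 1 2 ⋯ (n + 1)` and `y = 0`. Then `(xy) ^ n` brings
`n + 2` down to `2`, which `xy` sends to `0` but `yx` to `1`. -/

namespace PlacticLike

universe u v

/-! ### Identities pass to the generated variety. -/

section Varieties

/-- The monoids satisfying a given identity form a variety. -/
theorem isVariety_satisfiesIdentity {X : Type v} (l r : FreeMonoid X) :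
    IsVariety {M : MonCat.{u} | SatisfiesIdentity M l r} where
  image M N hM f hf ψ := by
    -- By freeness, a set-theoretic section of `f` lifts the evaluation `ψ` to `M`.
    obtain ⟨g, hg⟩ := hf.hasRightInverse
    have hψ : ψ = f.comp (FreeMonoid.lift fun x => g (ψ (FreeMonoid.of x))) := by
      ext x
      simp [hg _]
    rw [hψ, MonoidHom.comp_apply, MonoidHom.comp_apply, hM]
  submonoid M hM S ψ := Subtype.ext (hM (S.subtype.comp ψ))
  product ι M hM ψ := funext fun i => hM i ((Pi.evalMonoidHom (fun i => (M i : Type u)) i).comp ψ)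

/-- Every monoid in the variety generated by `M` satisfies the identities of `M`. -/
theorem SatisfiesIdentity.of_mem_variety {M : Type u} [Monoid M] {X : Type v}
    {l r : FreeMonoid X} (h : SatisfiesIdentity M l r) {N : MonCat.{u}} (hN : N ∈ variety M) :
    SatisfiesIdentity N l r :=
  hN {N | SatisfiesIdentity N l r} ⟨isVariety_satisfiesIdentity l r, h⟩

end Varieties

/-! ### Stabilization of the bottom row under repeated insertion. -/

section PatienceSorting

variable {α : Type u} [LinearOrder α]

/-- The bottom row of a tableau. -/
def bottomRow (T : List (List α)) : List α :=
  T.filterMap List.head?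

theorem Above.lt_of_mem_bottomRow {T : List (List α)} {b : WithBot α} (hT : Above b T) {a : α}
    (ha : a ∈ bottomRow T) : b < a := by
  induction T generalizing b with
  | nil => simp [bottomRow] at ha
  | cons D T ih =>
    cases D with
    | nil => exact hT.elim
    | cons d D =>
      obtain rfl | ha : a = d ∨ a ∈ bottomRow T := by simpa [bottomRow] using ha
      · exact hT.1
      · exact hT.1.trans (ih hT.2 ha)

theorem mem_bottomRow_rpsInsert_self (T : List (List α)) (a : α) :
    a ∈ bottomRow (rpsInsert T a) := by
  fun_induction rpsInsert T a <;> simp_all [bottomRow]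

/-- An entry `b` of the bottom row survives the insertion of a letter that is at least `b` or
already belongs to the bottom row. -/
theorem mem_bottomRow_rpsInsert {T : List (List α)} {c : WithBot α} (hT : Above c T) {a b : α}
    (hb : b ∈ bottomRow T) (h : b ≤ a ∨ a ∈ bottomRow T) : b ∈ bottomRow (rpsInsert T a) := by
  induction T generalizing c with
  | nil => simp [bottomRow] at hb
  | cons D T ih =>
    cases D with
    | nil => exact hT.elim
    | cons d D =>
      have hlt : ∀ e ∈ bottomRow T, d < e := fun e he =>
        WithBot.coe_lt_coe.1 (hT.2.lt_of_mem_bottomRow he)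
      have hb' : b = d ∨ b ∈ bottomRow T := by simpa [bottomRow] using hb
      have h' : b ≤ a ∨ a = d ∨ a ∈ bottomRow T := by simpa [bottomRow] using h
      by_cases had : a ≤ d
      -- Here `a` covers `d`, so `b` could be lost only if `b = d`; but then `h'` forces `a = d`.
      · have key : b = a ∨ b ∈ bottomRow T := by grind
        simpa [rpsInsert, had, bottomRow] using key
      · have key : b = d ∨ b ∈ bottomRow (rpsInsert T a) :=
          hb'.imp_right fun hb => ih hT.2 hb (h'.imp_right fun h' =>
            h'.resolve_left fun h => had h.le)
        simpa [rpsInsert, had, bottomRow] using key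

/-- Letters of the bottom row can be inserted in any order. -/
theorem rpsInsert_comm {T : List (List α)} {c : WithBot α} (hT : Above c T) {a b : α}
    (ha : a ∈ bottomRow T) (hb : b ∈ bottomRow T) :
    rpsInsert (rpsInsert T a) b = rpsInsert (rpsInsert T b) a := by
  induction T generalizing c with
  | nil => simp [bottomRow] at hb
  | cons D T ih =>
    cases D with
    | nil => exact hT.elim
    | cons d D =>
      have hlt : ∀ e ∈ bottomRow T, d < e := fun e he =>
        WithBot.coe_lt_coe.1 (hT.2.lt_of_mem_bottomRow he)
      obtain rfl | ha' : a = d ∨ a ∈ bottomRow T := by simpa [bottomRow] using ha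
      · obtain rfl | hb' : b = a ∨ b ∈ bottomRow T := by simpa [bottomRow] using hb
        · rfl
        · simp [rpsInsert, not_le.2 (hlt b hb')]
      · obtain rfl | hb' : b = d ∨ b ∈ bottomRow T := by simpa [bottomRow] using hb
        · simp [rpsInsert, not_le.2 (hlt a ha')]
        · simp [rpsInsert, not_le.2 (hlt a ha'), not_le.2 (hlt b hb'), ih hT.2 ha' hb']

/-- `T` has a strictly increasing bottom row, which contains the letters of `S`
satisfying `p`. -/
def Saturated (S : Set α) (p : α → Prop) (T : List (List α)) : Prop :=
  Above ⊥ T ∧ ∀ a ∈ S, p a → a ∈ bottomRow T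

/-- Only a letter `c ≤ b` could cover a protected `b`; as `p` is downward closed, such a `c` is
already in the bottom row and lands on its own column. -/
theorem Saturated.rpsInsert {S : Set α} {p : α → Prop} (hp : ∀ a b, a ≤ b → p b → p a)
    {T : List (List α)} (hT : Saturated S p T) {c : α} (hc : c ∈ S) :
    Saturated S p (rpsInsert T c) := by
  refine ⟨above_rpsInsert T ⊥ c hT.1 (WithBot.bot_lt_coe c), fun b hb hpb => ?_⟩
  refine mem_bottomRow_rpsInsert hT.1 (hT.2 b hb hpb) ?_
  rcases le_total b c with h | h
  · exact Or.inl h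
  · exact Or.inr (hT.2 c hc (hp c b h hpb))

theorem Saturated.foldl {S : Set α} {p : α → Prop} (hp : ∀ a b, a ≤ b → p b → p a)
    {T : List (List α)} (hT : Saturated S p T) {w : List α} (hw : ∀ a ∈ w, a ∈ S) :
    Saturated S p (w.foldl PlacticLike.rpsInsert T) := by
  induction w generalizing T with
  | nil => exact hT
  | cons c w ih =>
    exact ih (hT.rpsInsert hp (hw c (by simp))) fun a ha => hw a (by simp [ha])

/-- Saturation by all of `S` persists under insertion, so swaps of adjacent letters can be made
anywhere in the word. -/
theorem Saturated.foldl_perm {S : Set α} {T : List (List α)}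
    (hT : Saturated S (fun _ => True) T) {w w' : List α} (hww' : w.Perm w')
    (hw : ∀ a ∈ w, a ∈ S) :
    w.foldl PlacticLike.rpsInsert T = w'.foldl PlacticLike.rpsInsert T := by
  induction hww' generalizing T with
  | nil => rfl
  | cons c _ ih =>
    exact ih (hT.rpsInsert (fun _ _ _ _ => trivial) (hw c (by simp)))
      fun a ha => hw a (by simp [ha])
  | swap a b w =>
    simp only [List.foldl_cons]
    rw [rpsInsert_comm hT.1 (hT.2 b (hw b (by simp)) trivial) (hT.2 a (hw a (by simp)) trivial)]
  | trans h₁ _ ih₁ ih₂ =>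
    exact (ih₁ hT hw).trans (ih₂ hT fun a ha => hw a (h₁.mem_iff.2 ha))

/-- Inserting a word `w` over `Fin n` once more adds its next smallest letter to the stable part
of the bottom row. -/
theorem Saturated.foldl_succ {n : ℕ} {w : List (Fin n)} {i : ℕ} {T : List (List (Fin n))}
    (hT : Saturated {a | a ∈ w} (fun a => a.val < i) T) :
    Saturated {a | a ∈ w} (fun a => a.val < i + 1) (w.foldl PlacticLike.rpsInsert T) := by
  have mono (j : ℕ) (a b : Fin n) (h : a ≤ b) (hb : b.val < j) : a.val < j :=
    lt_of_le_of_lt h hb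
  by_cases hi : ∃ c ∈ w, c.val = i
  · obtain ⟨c, hc, rfl⟩ := hi
    -- Right after its insertion `c` is in the bottom row, and from then on the stronger saturation
    -- is preserved through `w₂`.
    obtain ⟨w₁, w₂, hw⟩ := List.append_of_mem hc
    have h₁ := hT.foldl (mono _) (w := w₁) fun a ha => by simp [hw, ha]
    have h₂ := h₁.rpsInsert (mono _) (c := c) hc
    have h₃ : Saturated {a | a ∈ w} (fun a => a.val < c.val + 1)
        (PlacticLike.rpsInsert (w₁.foldl PlacticLike.rpsInsert T) c) := by
      refine ⟨h₂.1, fun a ha hac => ?_⟩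
      rcases Nat.lt_succ_iff_lt_or_eq.1 hac with h | h
      · exact h₂.2 a ha h
      · rw [Fin.ext h]
        exact mem_bottomRow_rpsInsert_self _ _
    have h₄ := h₃.foldl (mono _) (w := w₂) fun a ha => by simp [hw, ha]
    have heq : w.foldl PlacticLike.rpsInsert T = w₂.foldl PlacticLike.rpsInsert
        (PlacticLike.rpsInsert (w₁.foldl PlacticLike.rpsInsert T) c) := by
      conv_lhs => rw [hw, List.foldl_append, List.foldl_cons]
    rwa [heq]
  · have h := hT.foldl (mono _) (w := w) fun a ha => ha
    refine ⟨h.1, fun a ha hai => h.2 a ha ?_⟩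
    exact (Nat.lt_succ_iff_lt_or_eq.1 hai).resolve_right fun h' => hi ⟨a, ha, h'⟩

theorem saturated_rpsTableau_pow {n : ℕ} (w : FreeMonoid (Fin n)) (i : ℕ) :
    Saturated {a | a ∈ w.toList} (fun a => a.val < i) (rpsTableau (w ^ i)) := by
  induction i with
  | zero => exact ⟨trivial, fun a _ h => (Nat.not_lt_zero _ h).elim⟩
  | succ i ih =>
    rw [pow_succ, rpsTableau_mul]
    exact ih.foldl_succ

/-- Over `Fin n`, after `n` copies of `w` the order of the letters of `w` no longer matters. -/
theorem rpsTableau_pow_mul_perm {n : ℕ} (w : FreeMonoid (Fin n)) {w₁ w₂ : FreeMonoid (Fin n)}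
    (h : w₁.toList.Perm w₂.toList) (hw : ∀ a ∈ w₁.toList, a ∈ w.toList) :
    rpsTableau (w ^ n * w₁) = rpsTableau (w ^ n * w₂) := by
  have hs := saturated_rpsTableau_pow w n
  rw [rpsTableau_mul, rpsTableau_mul]
  -- Values in `Fin n` are below `n`, so at exponent `n` the bound is no restriction.
  exact Saturated.foldl_perm (S := {a | a ∈ w.toList}) ⟨hs.1, fun a ha _ => hs.2 a ha a.isLt⟩ h hw

/-- `rPS_n` satisfies the identity `(xy)^{n+1} ≈ (xy)^n yx`. -/
theorem satisfiesIdentity_rps (n : ℕ) :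
    SatisfiesIdentity (RPS n)
      ((FreeMonoid.of (0 : Fin 2) * FreeMonoid.of (1 : Fin 2)) ^ (n + 1))
      ((FreeMonoid.of (0 : Fin 2) * FreeMonoid.of (1 : Fin 2)) ^ n *
        (FreeMonoid.of (1 : Fin 2) * FreeMonoid.of (0 : Fin 2))) := by
  intro ψ
  obtain ⟨x, hx⟩ := Con.mk'_surjective (c := rpsCon (Fin n)) (ψ (FreeMonoid.of 0))
  obtain ⟨y, hy⟩ := Con.mk'_surjective (c := rpsCon (Fin n)) (ψ (FreeMonoid.of 1))
  simp only [map_mul, map_pow, ← hx, ← hy]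
  simp only [← map_mul, ← map_pow]
  refine (Con.eq _).2 ?_
  rw [pow_succ]
  refine rpsTableau_pow_mul_perm (x * y) ?_ fun a ha => ha
  simpa using List.perm_append_comm

end PatienceSorting

/-! ### An action of the stylic monoid separating the two sides. -/

section Stylic

/-- The transformation of `ℕ` sending `a + 1` to `a` and fixing everything else. A word in such
transformations, the leftmost acting first, sends `m` to `0` if and only if it has the subsequence
`m - 1, …, 1, 0`. -/
def descend (a k : ℕ) : ℕ :=
  if k = a + 1 then a else k

/-- The stylic monoid acts on `ℕ` from the right, the letters acting by `descend`. -/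
def stylDescend (m : ℕ) : Styl m →* (Function.End ℕ)ᵐᵒᵖ :=
  PresentedMonoid.lift (M := (Function.End ℕ)ᵐᵒᵖ) (rels := StylRel)
      (fun a : Fin m => MulOpposite.op (descend a)) <| by
    rintro _ _ (⟨_, _, (⟨a, b, c, h₁, h₂⟩ | ⟨a, b, c, h₁, h₂⟩)⟩ | a)
    all_goals
      simp only [map_mul, FreeMonoid.lift_eval_of]
      refine MulOpposite.unop_injective (funext fun k => ?_)
    -- For `a < c`, `descend a` and `descend c` commute except at `k = c + 1` when `c = a + 1`. Then
    -- `b = a`, and the last letter merges the two results.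
    · change descend b (descend c (descend a k)) = descend b (descend a (descend c k))
      simp only [Fin.lt_def, Fin.le_def, descend] at *
      grind
    -- In the exceptional case `c = a + 1` one has `b = c`, and the first letter moves `c + 1` away
    -- beforehand.
    · change descend c (descend a (descend b k)) = descend a (descend c (descend b k))
      simp only [Fin.lt_def, Fin.le_def, descend] at *
      grind
    · change descend a (descend a k) = descend a k
      simp only [descend]
      grind

/-- The result of acting with `s` on `k`. -/
def stylAct {m : ℕ} (s : Styl m) (k : ℕ) : ℕ :=
  (stylDescend m s).unop k

theorem stylAct_one {m : ℕ} (k : ℕ) : stylAct (1 : Styl m) k = k := by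
  rw [stylAct, map_one]
  rfl

theorem stylAct_mul {m : ℕ} (s t : Styl m) (k : ℕ) :
    stylAct (s * t) k = stylAct t (stylAct s k) := by
  rw [stylAct, map_mul]
  rfl

theorem stylAct_of {m : ℕ} (a : Fin m) (k : ℕ) :
    stylAct (PresentedMonoid.of StylRel a) k = descend a k :=
  rfl

/-- The product `1 2 ⋯ N` of letters of `Fin m` moves each of `2, …, N + 1` down by one. -/
theorem exists_stylAct_eq {m : ℕ} (N : ℕ) (hN : N < m) :
    ∃ s : Styl m, ∀ k, stylAct s k = if 2 ≤ k ∧ k ≤ N + 1 then k - 1 else k := by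
  induction N with
  | zero => exact ⟨1, fun k => by rw [stylAct_one, if_neg (by omega)]⟩
  | succ N ih =>
    obtain ⟨s, hs⟩ := ih (by omega)
    refine ⟨s * PresentedMonoid.of StylRel ⟨N + 1, hN⟩, fun k => ?_⟩
    rw [stylAct_mul, stylAct_of, hs]
    simp only [descend]
    grind

/-- `styl_{n+2}` does not satisfy the identity `(xy)^{n+1} ≈ (xy)^n yx`. -/
theorem not_satisfiesIdentity_styl (n : ℕ) :
    ¬ SatisfiesIdentity (Styl (n + 2))
      ((FreeMonoid.of (0 : Fin 2) * FreeMonoid.of (1 : Fin 2)) ^ (n + 1))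
      ((FreeMonoid.of (0 : Fin 2) * FreeMonoid.of (1 : Fin 2)) ^ n *
        (FreeMonoid.of (1 : Fin 2) * FreeMonoid.of (0 : Fin 2))) := by
  intro h
  obtain ⟨x, hx⟩ := exists_stylAct_eq (m := n + 2) (n + 1) (by omega)
  set y : Styl (n + 2) := PresentedMonoid.of StylRel 0
  have hy (k : ℕ) : stylAct y k = if k = 1 then 0 else k := stylAct_of 0 k
  have hpow (i : ℕ) (hi : i ≤ n) : stylAct ((x * y) ^ i) (n + 2) = n + 2 - i := by
    induction i with
    | zero => rw [pow_zero, stylAct_one, Nat.sub_zero]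
    | succ i ih =>
      rw [pow_succ, stylAct_mul, stylAct_mul, ih (by omega), hx, hy]
      -- The current value is at least `3`, so `x` lowers it by one to at least `2`, which `y`
      -- fixes.
      grind
  have hxy := congrArg (stylAct · (n + 2)) (h (FreeMonoid.lift ![x, y]))
  have hn : n + 2 - n = 2 := by omega
  -- From `2`, `xy` gives `2 → 1 → 0`, while `yx` gives `2 → 2 → 1`.
  simp [pow_succ, stylAct_mul, hpow n le_rfl, hn, hx, hy] at hxy

end Stylic

end PlacticLike

theorem mainTheorem12 (n : ℕ) :
    PlacticLike.SatisfiesIdentity (PlacticLike.RPS n)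
      ((FreeMonoid.of (0 : Fin 2) * FreeMonoid.of (1 : Fin 2)) ^ (n + 1))
      ((FreeMonoid.of (0 : Fin 2) * FreeMonoid.of (1 : Fin 2)) ^ n *
        (FreeMonoid.of (1 : Fin 2) * FreeMonoid.of (0 : Fin 2))) ∧
    MonCat.of (PlacticLike.Styl (n + 2)) ∉ PlacticLike.variety (PlacticLike.RPS n) := by
  exact ⟨PlacticLike.satisfiesIdentity_rps n, fun h =>
    PlacticLike.not_satisfiesIdentity_styl n ((PlacticLike.satisfiesIdentity_rps n).of_mem_variety h)⟩
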